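/- **Setting.** Let $AP$ be a set of atomic propositions. A literal is $p$ or $\neg p$ with $p\in AP$; $P,Q,R,S$ denote finite disjunctions of pairwise different literals (treated as sets of literals; the empty disjunction is $0$). An *SNF clause* is an initial clause $P$, a global clause $\mathbf G(P\vee\mathbf X Q)$ (written $\mathbf G(P)$ if its $\mathbf X$ part $Q$ is empty), or an eventuality clause $\mathbf G(P\vee\mathbf F l)$ with eventuality literal $l$. The empty clause $\Box$ is $0$ or $\mathbf G(0)$. A set of SNF clauses is unsatisfiable if no infinite word over $2^{AP}$ satisfies all of its clauses (as LTL formulas) at position $0$. Let $C$ be a finite set of SNF clauses, and for every eventuality literal $l$ of $C$ let $w_l$ be a fresh proposition (not occurring in $C$, and different for different $l$). **Production rules.** There is a main partition $M$ of clauses and one partition $L$ for every iteration of a loop search. The rules are the following; a premise marked $*$ is linked to the conclusion by an edge, the other premises are not. *Saturation* (in $M$): (init-ii) $P\vee l\,{}^*,\ \neg l\vee Q\,{}^*\Rightarrow P\vee Q$; (init-in) $P\vee l\,{}^*,\ \mathbf G(\neg l\vee Q)^*\Rightarrow P\vee Q$; (step-nn) $\mathbf G(P\vee l)^*,\ \mathbf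 G(\neg l\vee Q)^*\Rightarrow\mathbf G(P\vee Q)$; (step-nx) $\mathbf G(P\vee l)^*,\ \mathbf G(Q\vee\mathbf X(\neg l\vee R))^*\Rightarrow\mathbf G(Q\vee\mathbf X(P\vee R))$; (step-xx, also used within a partition $L$) $\mathbf G(P\vee\mathbf X(Q\vee l))^*,\ \mathbf G(R\vee\mathbf X(\neg l\vee S))^*\Rightarrow\mathbf G(P\vee R\vee\mathbf X(Q\vee S))$. *Augmentation* (in $M$): (aug1) $\mathbf G(P\vee\mathbf F l)^*\Rightarrow\mathbf G(P\vee l\vee w_l)$; (aug2) $\mathbf G(P\vee\mathbf F l)\Rightarrow\mathbf G(\neg w_l\vee\mathbf X(l\vee w_l))$. *Loop search for* $\mathbf G(Q\vee\mathbf F l)\in C$: (BFS-loop-it-init-x) $c=\mathbf G(P\vee\mathbf X R)^*$ in $M$ with $R\neq\emptyset$ $\Rightarrow$ $c$ in $L$; (BFS-loop-it-init-n) $\mathbf G(P)^*$ in $M$ $\Rightarrow\mathbf G(\mathbf X P)$ in $L$; (BFS-loop-it-init-c) $\mathbf G(P)$ from the previous iteration and $\mathbf G(Q\vee\mathbf F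 l)$ $\Rightarrow\mathbf G(\mathbf X(P\vee l))$ in $L$; (BFS-loop-it-sub) if $\mathbf G(P)\in L$ subsumes a clause $\mathbf G(R)$ of the previous iteration ($P\subseteq R$), there is an edge from $\mathbf G(P)$ to the clause $\mathbf G(\mathbf X(R\vee l))$ in $L$ (no clause is produced); (BFS-loop-conclusion1) $\mathbf G(P)^*$ in $L$, $\mathbf G(Q\vee\mathbf F l)^*$ in $M$ $\Rightarrow\mathbf G(P\vee Q\vee l)$ in $M$; (BFS-loop-conclusion2) $\mathbf G(P)^*$ in $L$, $\mathbf G(Q\vee\mathbf F l)$ in $M$ $\Rightarrow\mathbf G(\neg w_l\vee\mathbf X(P\vee l))$ in $M$. **Algorithm** (rules are applied in any order). Put $M:=C$; return *unsat* if $\Box\in M$. Saturate $M$ (apply the saturation rules until no new clause is generated), returning *unsat* if $\Box$ is generated. Apply aug1 and aug2 to the eventuality clauses; saturate again, returning *unsat* if $\Box\in M$. Then, until $M$ no longer changes in a full pass (in which case return *sat*), do the following for each eventuality clause $c=\mathbf G(Q\vee\mathbf F l)\in C$. Put $C':=\{\Box\}$ and repeat the following iteration: create a new partition $L$; apply to it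 BFS-loop-it-init-x and BFS-loop-it-init-n for all global clauses in $M$, and BFS-loop-it-init-c for all clauses in $C'$; saturate $L$ under step-xx; say that a loop is *found* if each clause of the old $C'$ is subsumed by a clause $\mathbf G(P)\in L$; replace $C'$ by the set of all clauses of the form $\mathbf G(P)$ in $L$. The iterations end when a loop is found or $C'=\emptyset$. If a loop is found, apply BFS-loop-conclusion1 and BFS-loop-conclusion2 with $c$ to all clauses in $C'$, and saturate $M$, returning *unsat* if $\Box\in M$. **Resolution graph.** During an execution a directed graph $G$ is built. It starts with one vertex in the main partition for each clause in $C$ and no edges. Each rule application that generates a clause that is new in its partition adds a vertex in that partition, labelled with the clause, and edges to it from the vertices of those premises that are marked $*$. The first application of BFS-loop-it-sub to each clause of the old $C'$ in a subsumption test adds the edge described above. **Theorem (Unsatisfiability of the UC in SNF).** Suppose that an execution of the algorithm on $C$ returns *unsat*, let $G$ be the resolution graph built by it, and let $v_\Box$ be a vertex in the main partition of $G$ that is labelled with the empty clause. Let $C^{uc}\subseteq C$ be the set of all $c\in C$ that label a vertex in the main partition of $G$ from which there is a directed path (possibly of length $0$) to $v_\Box$. Then $C^{uc}$ is unsatisfiable.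 -/

import Mathlib

namespace TR

universe u

/-! ### Propositional linear temporal logic -/

/-- LTL formulas over a set `α` of atomic propositions. -/
inductive LTL (α : Type u) : Type u
  | ff : LTL α
  | tt : LTL α
  | atom (p : α) : LTL α
  | not (φ : LTL α) : LTL α
  | or (φ ψ : LTL α) : LTL α
  | and (φ ψ : LTL α) : LTL α
  | next (φ : LTL α) : LTL α
  | until (φ ψ : LTL α) : LTL α
  | releases (φ ψ : LTL α) : LTL α
  | finally (φ : LTL α) : LTL α
  | globally (φ : LTL α) : LTL α

/-- `φ.Sat σ i`: the infinite word `σ` of valuations satisfies `φ` at position `i`. -/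
def LTL.Sat {α : Type u} (σ : ℕ → Set α) : LTL α → ℕ → Prop
  | .ff, _ => False
  | .tt, _ => True
  | .atom p, i => p ∈ σ i
  | .not φ, i => ¬ φ.Sat σ i
  | .or φ ψ, i => φ.Sat σ i ∨ ψ.Sat σ i
  | .and φ ψ, i => φ.Sat σ i ∧ ψ.Sat σ i
  | .next φ, i => φ.Sat σ (i + 1)
  | .until φ ψ, i => ∃ j, i ≤ j ∧ ψ.Sat σ j ∧ ∀ k, i ≤ k → k < j → φ.Sat σ k
  | .releases φ ψ, i => ∀ j, i ≤ j → ψ.Sat σ j ∨ ∃ k, i ≤ k ∧ k < j ∧ φ.Sat σ k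
  | .finally φ, i => ∃ j, i ≤ j ∧ φ.Sat σ j
  | .globally φ, i => ∀ j, i ≤ j → φ.Sat σ j

/-! ### Separated normal form -/

/-- A literal: the proposition `atom` if `sign` is true, its negation otherwise. -/
structure Literal (α : Type u) : Type u where
  atom : α
  sign : Bool
  deriving DecidableEq

/-- The complementary literal. -/
def Literal.neg {α : Type u} (l : Literal α) : Literal α := ⟨l.atom, !l.sign⟩

/-- The positive literal of a proposition. -/
def Literal.pos {α : Type u} (p : α) : Literal α := ⟨p, true⟩

def Literal.toLTL {α : Type u} (l : Literal α) : LTL α :=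
  if l.sign then .atom l.atom else .not (.atom l.atom)

/-- A disjunction of pairwise different literals. -/
abbrev Disj (α : Type u) : Type u := Finset (Literal α)

/-- The disjunction as an LTL formula; the empty disjunction is false. -/
noncomputable def Disj.toLTL {α : Type u} (P : Disj α) : LTL α :=
  ((Finset.toList P).map Literal.toLTL).foldr LTL.or LTL.ff

/-- SNF clauses. `init P` is the initial clause `P`; `global P Q` is `G (P ∨ X Q)`, where
`global P ∅` is `G P`; `ev P l` is the eventuality clause `G (P ∨ F l)`. -/
inductive Clause (α : Type u) : Type u
  | init (P : Disj α) : Clause α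
  | global (P Q : Disj α) : Clause α
  | ev (P : Disj α) (l : Literal α) : Clause α
  deriving DecidableEq

noncomputable def Clause.toLTL {α : Type u} : Clause α → LTL α
  | .init P => Disj.toLTL P
  | .global P Q => .globally (.or (Disj.toLTL P) (.next (Disj.toLTL Q)))
  | .ev P l => .globally (.or (Disj.toLTL P) (.finally l.toLTL))

/-- The empty clause, in one of its two forms `0` and `G 0`. -/
def Clause.IsEmpty {α : Type u} (c : Clause α) : Prop := c = .init ∅ ∨ c = .global ∅ ∅

def Clause.IsEventuality {α : Type u} (c : Clause α) : Prop := ∃ P l, c = .ev P l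

/-- The propositions that occur in a clause. -/
def Clause.atoms {α : Type u} : Clause α → Set α
  | .init P => {p | ∃ l ∈ P, l.atom = p}
  | .global P Q => {p | (∃ l ∈ P, l.atom = p) ∨ ∃ l ∈ Q, l.atom = p}
  | .ev P l => {p | (∃ l' ∈ P, l'.atom = p) ∨ l.atom = p}

/-- A set of SNF clauses is unsatisfiable: no infinite word satisfies (the conjunction of) its
clauses at position 0. -/
def Unsat {α : Type u} (S : Set (Clause α)) : Prop :=
  ¬ ∃ σ : ℕ → Set α, ∀ c ∈ S, c.toLTL.Sat σ 0

/-- `w l` is a fresh proposition for each eventuality literal `l` of `C`: it does not occur in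
`C`, and different eventuality literals get different propositions. -/
structure IsFresh {α : Type u} (C : Finset (Clause α)) (w : Literal α → α) : Prop where
  not_occurs : ∀ P l, Clause.ev P l ∈ C → ∀ c ∈ C, w l ∉ c.atoms
  inj : ∀ P l P' l', Clause.ev P l ∈ C → Clause.ev P' l' ∈ C → w l = w l' → l = l'

/-! ### Resolution graphs -/

/-- The main partition, and one partition for each iteration of a BFS loop search. -/
inductive Part : Type
  | main : Part
  | loop (i : ℕ) : Part

/-- A vertex of a resolution graph. A vertex is only created for a clause that is new in its
partition, so that a vertex is determined by its partition and its label. -/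
structure Vertex (α : Type u) : Type u where
  part : Part
  clause : Clause α

/-- A resolution graph: vertices (with their partition and label), edges `(premise, conclusion)`,
and the number of loop partitions created so far. The clauses in a partition of the algorithm
are the labels of the vertices in that partition. -/
structure ResGraph (α : Type u) : Type u where
  V : Set (Vertex α)
  E : Set (Vertex α × Vertex α)
  loops : ℕ

namespace ResGraph

variable {α : Type u}

/-- One vertex in the main partition per input clause, no edges, no loop partitions. -/
def initial (C : Finset (Clause α)) : ResGraph α where
  V := {v | v.part = .main ∧ v.clause ∈ C}
  E := ∅
  loops := 0

/-- Add the vertex `v`, with edges from the vertices in `S`. -/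
def extend (G : ResGraph α) (S : Set (Vertex α)) (v : Vertex α) : ResGraph α where
  V := insert v G.V
  E := G.E ∪ {e | e.1 ∈ S ∧ e.2 = v}
  loops := G.loops

def addEdge (G : ResGraph α) (u v : Vertex α) : ResGraph α where
  V := G.V
  E := insert (u, v) G.E
  loops := G.loops

/-- Create a new (empty) loop partition; it is the one with number `G.loops`. -/
def newLoop (G : ResGraph α) : ResGraph α where
  V := G.V
  E := G.E
  loops := G.loops + 1

/-- The clauses in the main partition. -/
def mainClauses (G : ResGraph α) : Set (Clause α) := {c | (⟨.main, c⟩ : Vertex α) ∈ G.V}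

/-- The main partition contains the empty clause. -/
def HasEmpty (G : ResGraph α) : Prop := ∃ c ∈ G.mainClauses, c.IsEmpty

/-- The (bodies of the) global clauses with empty `X` part in loop partition `k`. -/
def emptyX (G : ResGraph α) (k : ℕ) : Set (Disj α) :=
  {P | (⟨.loop k, .global P ∅⟩ : Vertex α) ∈ G.V}

/-- `u` is backward reachable from `v`. -/
def BackReach (G : ResGraph α) (v u : Vertex α) : Prop :=
  Relation.ReflTransGen (fun a b => (a, b) ∈ G.E) u v

/-- The unsatisfiable core: the input clauses that label a vertex in the main partition which is
backward reachable from `v` (the vertex of the empty clause). -/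
def core (C : Finset (Clause α)) (G : ResGraph α) (v : Vertex α) : Set (Clause α) :=
  {c | c ∈ C ∧ ∃ u ∈ G.V, G.BackReach v u ∧ u.clause = c ∧ u.part = .main}

end ResGraph

/-! ### Production rules

In each of the following, `R V S v` says that, in a graph with vertex set `V`, an instance of one
of the rules has its premises in `V` and has the conclusion `v`, and that `S` is the set of those
premises from which an edge to the conclusion is drawn. -/

section Rules

variable {α : Type u} [DecidableEq α]

/-- Rule step-xx in the partition `p`. -/
inductive StepXX (p : Part) (V : Set (Vertex α)) : Set (Vertex α) → Vertex α → Prop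
  | step_xx (P Q R S : Disj α) (l : Literal α) (hl : l ∉ Q) (hl' : l.neg ∉ S)
      (h₁ : ⟨p, .global P (insert l Q)⟩ ∈ V) (h₂ : ⟨p, .global R (insert l.neg S)⟩ ∈ V) :
      StepXX p V {⟨p, .global P (insert l Q)⟩, ⟨p, .global R (insert l.neg S)⟩}
        ⟨p, .global (P ∪ R) (Q ∪ S)⟩

/-- The saturation rules in the main partition. -/
inductive Saturation (V : Set (Vertex α)) : Set (Vertex α) → Vertex α → Prop
  | init_ii (P Q : Disj α) (l : Literal α) (hl : l ∉ P) (hl' : l.neg ∉ Q)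
      (h₁ : ⟨.main, .init (insert l P)⟩ ∈ V) (h₂ : ⟨.main, .init (insert l.neg Q)⟩ ∈ V) :
      Saturation V {⟨.main, .init (insert l P)⟩, ⟨.main, .init (insert l.neg Q)⟩}
        ⟨.main, .init (P ∪ Q)⟩
  | init_in (P Q : Disj α) (l : Literal α) (hl : l ∉ P) (hl' : l.neg ∉ Q)
      (h₁ : ⟨.main, .init (insert l P)⟩ ∈ V) (h₂ : ⟨.main, .global (insert l.neg Q) ∅⟩ ∈ V) :
      Saturation V {⟨.main, .init (insert l P)⟩, ⟨.main, .global (insert l.neg Q) ∅⟩}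
        ⟨.main, .init (P ∪ Q)⟩
  | step_nn (P Q : Disj α) (l : Literal α) (hl : l ∉ P) (hl' : l.neg ∉ Q)
      (h₁ : ⟨.main, .global (insert l P) ∅⟩ ∈ V)
      (h₂ : ⟨.main, .global (insert l.neg Q) ∅⟩ ∈ V) :
      Saturation V {⟨.main, .global (insert l P) ∅⟩, ⟨.main, .global (insert l.neg Q) ∅⟩}
        ⟨.main, .global (P ∪ Q) ∅⟩
  | step_nx (P Q R : Disj α) (l : Literal α) (hl : l ∉ P) (hl' : l.neg ∉ R)
      (h₁ : ⟨.main, .global (insert l P) ∅⟩ ∈ V)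
      (h₂ : ⟨.main, .global Q (insert l.neg R)⟩ ∈ V) :
      Saturation V {⟨.main, .global (insert l P) ∅⟩, ⟨.main, .global Q (insert l.neg R)⟩}
        ⟨.main, .global Q (P ∪ R)⟩
  | step_xx (S : Set (Vertex α)) (v : Vertex α) (h : StepXX .main V S v) : Saturation V S v

/-- The augmentation rules; `w l` is the proposition "waiting for `l`". The conclusion of aug2 is
not linked to its premise. -/
inductive Augmentation (w : Literal α → α) (V : Set (Vertex α)) :
    Set (Vertex α) → Vertex α → Prop
  | aug1 (P : Disj α) (l : Literal α) (h : ⟨.main, .ev P l⟩ ∈ V) :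
      Augmentation w V {⟨.main, .ev P l⟩} ⟨.main, .global (P ∪ {l, .pos (w l)}) ∅⟩
  | aug2 (P : Disj α) (l : Literal α) (h : ⟨.main, .ev P l⟩ ∈ V) :
      Augmentation w V ∅ ⟨.main, .global {(Literal.pos (w l)).neg} {l, .pos (w l)}⟩

/-- The rules that initialize loop partition `k` in a search for a loop in `¬ l`, where `prev` is
the set of (bodies of) global clauses with empty `X` part of the previous iteration. The conclusion
of BFS-loop-it-init-c is linked to neither of its premises. -/
inductive LoopInit (l : Literal α) (prev : Set (Disj α)) (k : ℕ) (V : Set (Vertex α)) :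
    Set (Vertex α) → Vertex α → Prop
  | init_x (P Q : Disj α) (hQ : Q.Nonempty) (h : ⟨.main, .global P Q⟩ ∈ V) :
      LoopInit l prev k V {⟨.main, .global P Q⟩} ⟨.loop k, .global P Q⟩
  | init_n (P : Disj α) (h : ⟨.main, .global P ∅⟩ ∈ V) :
      LoopInit l prev k V {⟨.main, .global P ∅⟩} ⟨.loop k, .global ∅ P⟩
  | init_c (P : Disj α) (h : P ∈ prev) :
      LoopInit l prev k V ∅ ⟨.loop k, .global ∅ (insert l P)⟩

/-- The conclusions of a successful search for the eventuality clause `ev Q l`, whose last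
iteration has loop partition `k`. The conclusion of BFS-loop-conclusion2 is not linked to the
eventuality clause. -/
inductive LoopConclusion (w : Literal α → α) (Q : Disj α) (l : Literal α) (k : ℕ)
    (V : Set (Vertex α)) : Set (Vertex α) → Vertex α → Prop
  | conclusion1 (P : Disj α) (h₁ : ⟨.loop k, .global P ∅⟩ ∈ V) (h₂ : ⟨.main, .ev Q l⟩ ∈ V) :
      LoopConclusion w Q l k V {⟨.loop k, .global P ∅⟩, ⟨.main, .ev Q l⟩}
        ⟨.main, .global (P ∪ Q ∪ {l}) ∅⟩
  | conclusion2 (P : Disj α) (h₁ : ⟨.loop k, .global P ∅⟩ ∈ V) (h₂ : ⟨.main, .ev Q l⟩ ∈ V) :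
      LoopConclusion w Q l k V {⟨.loop k, .global P ∅⟩}
        ⟨.main, .global {(Literal.pos (w l)).neg} (P ∪ {l})⟩

end Rules

/-- No instance of the rules `R` generates a new clause. -/
def Exhausted {α : Type u} (R : Set (Vertex α) → Set (Vertex α) → Vertex α → Prop)
    (G : ResGraph α) : Prop :=
  ∀ S v, R G.V S v → v ∈ G.V

/-- An instance of one of the rules `R` generates a new clause in `G`, which leads to `G'`. -/
def Generates {α : Type u} (R : Set (Vertex α) → Set (Vertex α) → Vertex α → Prop)
    (G G' : ResGraph α) : Prop :=
  ∃ S v, R G.V S v ∧ v ∉ G.V ∧ G' = G.extend S v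

/-! ### The algorithm -/

/-- The variables of an iteration of a BFS loop search: `M'` and the eventuality clauses `todo`
that are still to be treated by the enclosing loops, the current eventuality clause `ev Q l`,
the set `prev` of (bodies of) global clauses with empty `X` part of the previous iteration
(`{□}` in the first iteration), and the number `k` of the loop partition. -/
structure Search (α : Type u) : Type u where
  M' : Set (Clause α)
  todo : Set (Clause α)
  Q : Disj α
  l : Literal α
  prev : Set (Disj α)
  k : ℕ

/-- The position of the algorithm. -/
inductive Phase (α : Type u) : Type u
  /-- before the initial test for the empty clause -/
  | start : Phase α
  /-- saturating the main partition; the execution continues with `next` -/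
  | saturate (next : Phase α) : Phase α
  | augment : Phase α
  /-- before the test `M' ≠ M` of the while loop -/
  | whileTest (M' : Set (Clause α)) : Phase α
  /-- in the for loop, with the eventuality clauses `todo` still to be treated -/
  | forEach (M' todo : Set (Clause α)) : Phase α
  | loopInit (s : Search α) : Phase α
  | loopSaturate (s : Search α) : Phase α
  /-- in the subsumption test, where the clauses in `D` have not been found to be subsumed yet -/
  | loopSubsume (s : Search α) (D : Set (Disj α)) : Phase α
  | loopConclude (s : Search α) : Phase α
  | unsat : Phase α
  | sat : Phase α

/-- One step of the algorithm with input `C`, together with the construction of the resolution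
graph. Where the algorithm leaves the order of rule applications open, any order is admitted. -/
inductive Step {α : Type u} [DecidableEq α] (C : Finset (Clause α)) (w : Literal α → α) :
    ResGraph α × Phase α → ResGraph α × Phase α → Prop
  | start_unsat (G) (h : G.HasEmpty) : Step C w (G, .start) (G, .unsat)
  | start_done (G) (h : ¬ G.HasEmpty) : Step C w (G, .start) (G, .saturate .augment)
  | saturate_apply (G G' next) (h : Generates Saturation G G') :
      Step C w (G, .saturate next) (G', .saturate next)
  | saturate_unsat (G next) (h : G.HasEmpty) : Step C w (G, .saturate next) (G, .unsat)
  | saturate_done (G next) (h : Exhausted Saturation G) (h' : ¬ G.HasEmpty) :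
      Step C w (G, .saturate next) (G, next)
  | augment_apply (G G') (h : Generates (Augmentation w) G G') :
      Step C w (G, .augment) (G', .augment)
  | augment_done (G) (h : Exhausted (Augmentation w) G) :
      Step C w (G, .augment) (G, .saturate (.whileTest ∅))
  | while_enter (G M') (h : M' ≠ G.mainClauses) :
      Step C w (G, .whileTest M') (G, .forEach G.mainClauses {c | c ∈ C ∧ c.IsEventuality})
  | while_exit (G M') (h : M' = G.mainClauses) : Step C w (G, .whileTest M') (G, .sat)
  | for_enter (G M' todo Q l) (h : Clause.ev Q l ∈ todo) :
      Step C w (G, .forEach M' todo)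
        (G.newLoop, .loopInit ⟨M', todo \ {.ev Q l}, Q, l, {∅}, G.loops⟩)
  | for_exit (G M') : Step C w (G, .forEach M' ∅) (G, .whileTest M')
  | loopInit_apply (G G' s) (h : Generates (LoopInit s.l s.prev s.k) G G') :
      Step C w (G, .loopInit s) (G', .loopInit s)
  | loopInit_done (G s) (h : Exhausted (LoopInit s.l s.prev s.k) G) :
      Step C w (G, .loopInit s) (G, .loopSaturate s)
  | loopSaturate_apply (G G' s) (h : Generates (StepXX (.loop s.k)) G G') :
      Step C w (G, .loopSaturate s) (G', .loopSaturate s)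
  | loopSaturate_done (G s) (h : Exhausted (StepXX (.loop s.k)) G) :
      Step C w (G, .loopSaturate s) (G, .loopSubsume s s.prev)
  /-- The first application of BFS-loop-it-sub to a clause `G R` of the previous iteration: it is
  subsumed by the clause `G P` of the current iteration. -/
  | subsume_apply (G s) (D) (R P : Disj α) (hR : R ∈ D) (hP : P ∈ G.emptyX s.k) (h : P ⊆ R) :
      Step C w (G, .loopSubsume s D)
        (G.addEdge ⟨.loop s.k, .global P ∅⟩ ⟨.loop s.k, .global ∅ (insert s.l R)⟩,
          .loopSubsume s (D \ {R}))
  /-- A loop has been found: all clauses of the previous iteration are subsumed. -/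
  | subsume_found (G s) : Step C w (G, .loopSubsume s ∅) (G, .loopConclude s)
  /-- No loop has been found, and there is nothing to start another iteration from. -/
  | subsume_fail (G s D) (h : ∃ R ∈ s.prev, ∀ P ∈ G.emptyX s.k, ¬ P ⊆ R)
      (h' : G.emptyX s.k = ∅) :
      Step C w (G, .loopSubsume s D) (G, .forEach s.M' s.todo)
  /-- No loop has been found, and the next iteration is entered. -/
  | subsume_repeat (G s D) (h : ∃ R ∈ s.prev, ∀ P ∈ G.emptyX s.k, ¬ P ⊆ R)
      (h' : G.emptyX s.k ≠ ∅) :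
      Step C w (G, .loopSubsume s D)
        (G.newLoop, .loopInit ⟨s.M', s.todo, s.Q, s.l, G.emptyX s.k, G.loops⟩)
  | conclude_apply (G G' s) (h : Generates (LoopConclusion w s.Q s.l s.k) G G') :
      Step C w (G, .loopConclude s) (G', .loopConclude s)
  | conclude_done (G s) (h : Exhausted (LoopConclusion w s.Q s.l s.k) G) :
      Step C w (G, .loopConclude s) (G, .saturate (.forEach s.M' s.todo))

/-- There is an execution of the algorithm with input `C` that returns "unsat" and constructs the
resolution graph `G`. -/
def ShowsUnsat {α : Type u} [DecidableEq α] (C : Finset (Clause α)) (w : Literal α → α)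
    (G : ResGraph α) : Prop :=
  Relation.ReflTransGen (Step C w) (ResGraph.initial C, .start) (G, .unsat)

end TR

namespace TR

universe u

variable {α : Type u}

/-! ### Semantics of clauses -/

/-! Suppose a word `σ` satisfies the core. Reinterpreting each fresh `w l` as "`l` holds at some
strictly later position" gives a word `τ` that agrees with `σ` on the clauses of `C`
(`exists_waitsFor`). Let `B` be the set of vertices from which the empty clause is reachable. It is
closed under predecessors, and the input clauses in it are core clauses. An induction along the
execution (`Step.inv`) shows that every main-partition clause in `B` holds in `τ`; the empty clause
cannot.

The invariant `GraphInv.sound` quantifies over all predecessor-closed `B` and all such `τ`, since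
the relevant `B` is known only once the graph is complete. New edges only shrink the family of
closed sets, so the invariant persists.

What needs an argument are the premises without an edge, whose truth in `τ` is not available. For
aug2 and BFS-loop-conclusion2 the eventuality clause serves only to fix the meaning of `w l`. For
BFS-loop-it-init-c, clauses of a loop partition are sound only conditionally (`LoopSound`). Once a
loop is found, the condition is discharged by following the BFS-loop-it-sub edges forward in time:
if `P` fails at `i`, some `R ∨ l` whose vertex is in `B` fails at `i + 1`, the edge brings a
subsuming `P' ⊆ R` into `B`, and `P'` fails at `i + 1` as well. Hence `l` fails at all later
positions (`LoopSound.loopFound`). Only the last iteration matters. -/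

/-- The disjunction `P` holds at position `i` of the word `σ`. -/
def Disj.Holds (σ : ℕ → Set α) (i : ℕ) (P : Disj α) : Prop := ∃ l ∈ P, l.toLTL.Sat σ i

theorem Literal.sat_neg (σ : ℕ → Set α) (i : ℕ) (l : Literal α) :
    l.neg.toLTL.Sat σ i ↔ ¬ l.toLTL.Sat σ i := by
  obtain ⟨p, s⟩ := l
  cases s <;> simp [Literal.neg, Literal.toLTL, LTL.Sat]

theorem Literal.sat_pos (σ : ℕ → Set α) (i : ℕ) (p : α) :
    (Literal.pos p).toLTL.Sat σ i ↔ p ∈ σ i := by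
  simp [Literal.pos, Literal.toLTL, LTL.Sat]

theorem Literal.sat_congr {σ τ : ℕ → Set α} {i : ℕ} {l : Literal α}
    (h : l.atom ∈ σ i ↔ l.atom ∈ τ i) : l.toLTL.Sat σ i ↔ l.toLTL.Sat τ i := by
  obtain ⟨p, s⟩ := l
  cases s <;> simpa [Literal.toLTL, LTL.Sat, not_iff_not] using h

theorem Disj.sat_toLTL (σ : ℕ → Set α) (i : ℕ) (P : Disj α) :
    (Disj.toLTL P).Sat σ i ↔ Disj.Holds σ i P := by
  have key : ∀ L : List (Literal α),
      ((L.map Literal.toLTL).foldr LTL.or LTL.ff).Sat σ i ↔ ∃ l ∈ L, l.toLTL.Sat σ i := by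
    intro L
    induction L with
    | nil => simp [LTL.Sat]
    | cons a L ih => simp [LTL.Sat, ih]
  simpa [Disj.toLTL, Disj.Holds] using key P.toList

theorem Disj.holds_empty (σ : ℕ → Set α) (i : ℕ) : ¬ Disj.Holds σ i (∅ : Disj α) := by
  simp [Disj.Holds]

theorem Disj.Holds.mono {σ : ℕ → Set α} {i : ℕ} {P Q : Disj α} (h : Disj.Holds σ i P)
    (hPQ : P ⊆ Q) : Disj.Holds σ i Q :=
  let ⟨l, hl, hs⟩ := h
  ⟨l, hPQ hl, hs⟩

theorem Disj.holds_congr {σ τ : ℕ → Set α} {i : ℕ} {P : Disj α}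
    (h : ∀ l ∈ P, (l.atom ∈ σ i ↔ l.atom ∈ τ i)) : Disj.Holds σ i P ↔ Disj.Holds τ i P := by
  unfold Disj.Holds
  exact exists_congr fun l => and_congr_right fun hl => Literal.sat_congr (h l hl)

section Decidable

variable [DecidableEq α]

theorem Disj.holds_insert (σ : ℕ → Set α) (i : ℕ) (l : Literal α) (P : Disj α) :
    Disj.Holds σ i (insert l P) ↔ l.toLTL.Sat σ i ∨ Disj.Holds σ i P := by
  simp [Disj.Holds]

theorem Disj.holds_union (σ : ℕ → Set α) (i : ℕ) (P Q : Disj α) :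
    Disj.Holds σ i (P ∪ Q) ↔ Disj.Holds σ i P ∨ Disj.Holds σ i Q := by
  simp [Disj.Holds, or_and_right, exists_or]

end Decidable

theorem Disj.holds_singleton (σ : ℕ → Set α) (i : ℕ) (l : Literal α) :
    Disj.Holds σ i {l} ↔ l.toLTL.Sat σ i := by
  simp [Disj.Holds]

/-- The clause `c` holds at the first position of `σ`. -/
def Clause.Holds (σ : ℕ → Set α) (c : Clause α) : Prop := c.toLTL.Sat σ 0

theorem Clause.holds_init (σ : ℕ → Set α) (P : Disj α) :
    (Clause.init P).Holds σ ↔ Disj.Holds σ 0 P :=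
  Disj.sat_toLTL σ 0 P

theorem Clause.holds_global (σ : ℕ → Set α) (P Q : Disj α) :
    (Clause.global P Q).Holds σ ↔ ∀ i, Disj.Holds σ i P ∨ Disj.Holds σ (i + 1) Q := by
  simp [Clause.Holds, Clause.toLTL, LTL.Sat, Disj.sat_toLTL]

theorem Clause.holds_ev (σ : ℕ → Set α) (P : Disj α) (l : Literal α) :
    (Clause.ev P l).Holds σ ↔ ∀ i, Disj.Holds σ i P ∨ ∃ j, i ≤ j ∧ l.toLTL.Sat σ j := by
  simp [Clause.Holds, Clause.toLTL, LTL.Sat, Disj.sat_toLTL]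

theorem Clause.IsEmpty.not_holds {c : Clause α} (h : c.IsEmpty) (σ : ℕ → Set α) :
    ¬ c.Holds σ := by
  rcases h with rfl | rfl
  · simp [Clause.holds_init, Disj.holds_empty]
  · simp [Clause.holds_global, Disj.holds_empty]

theorem Clause.holds_congr {σ τ : ℕ → Set α} {c : Clause α}
    (h : ∀ i, ∀ p ∈ c.atoms, (p ∈ σ i ↔ p ∈ τ i)) : c.Holds σ ↔ c.Holds τ := by
  cases c with
  | init P =>
    rw [Clause.holds_init, Clause.holds_init]
    exact Disj.holds_congr fun l hl => h 0 _ ⟨l, hl, rfl⟩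
  | global P Q =>
    rw [Clause.holds_global, Clause.holds_global]
    exact forall_congr' fun i => or_congr
      (Disj.holds_congr fun l hl => h i _ (Or.inl ⟨l, hl, rfl⟩))
      (Disj.holds_congr fun l hl => h (i + 1) _ (Or.inr ⟨l, hl, rfl⟩))
  | ev P l =>
    rw [Clause.holds_ev, Clause.holds_ev]
    exact forall_congr' fun i => or_congr
      (Disj.holds_congr fun l hl => h i _ (Or.inl ⟨l, hl, rfl⟩))
      (exists_congr fun j => and_congr_right fun _ => Literal.sat_congr (h j _ (Or.inr rfl)))

/-! ### Interpretation of the fresh propositions -/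

/-- In `τ`, each proposition `w l` means that the eventuality literal `l` of `C` holds at some
strictly later position. -/
def WaitsFor (C : Finset (Clause α)) (w : Literal α → α) (τ : ℕ → Set α) : Prop :=
  ∀ P l, Clause.ev P l ∈ C → ∀ i, w l ∈ τ i ↔ ∃ j, i < j ∧ l.toLTL.Sat τ j

/-- The new values of the fresh propositions are computed from `σ`, so nothing is circular.
Eventuality literals occur in `C`, hence avoid fresh propositions and keep their truth values. -/
theorem exists_waitsFor {C : Finset (Clause α)} {w : Literal α → α} (hw : IsFresh C w)
    (σ : ℕ → Set α) :
    ∃ τ, WaitsFor C w τ ∧ ∀ c ∈ C, c.Holds σ ↔ c.Holds τ := by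
  classical
  let τ : ℕ → Set α := fun i => {p | if ∃ P l, Clause.ev P l ∈ C ∧ w l = p
    then ∃ P l, Clause.ev P l ∈ C ∧ w l = p ∧ ∃ j, i < j ∧ l.toLTL.Sat σ j else p ∈ σ i}
  have hτ : ∀ c ∈ C, ∀ i, ∀ p ∈ c.atoms, (p ∈ σ i ↔ p ∈ τ i) := by
    intro c hc i p hp
    have hn : ¬ ∃ P l, Clause.ev P l ∈ C ∧ w l = p := by
      rintro ⟨P, l, h, rfl⟩
      exact hw.not_occurs P l h c hc hp
    simp [τ, hn]
  refine ⟨τ, fun P l h i => ?_, fun c hc => Clause.holds_congr (hτ c hc)⟩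
  have hl : ∀ j, l.toLTL.Sat τ j ↔ l.toLTL.Sat σ j := fun j =>
    (Literal.sat_congr (hτ _ h j _ (Or.inr rfl))).symm
  have hex : ∃ P' l', Clause.ev P' l' ∈ C ∧ w l' = w l := ⟨P, l, h, rfl⟩
  simp only [τ, Set.mem_ofPred_eq, if_pos hex]
  constructor
  · rintro ⟨P', l', h', he, j, hij, hj⟩
    obtain rfl := hw.inj _ _ _ _ h' h he
    exact ⟨j, hij, (hl j).2 hj⟩
  · rintro ⟨j, hij, hj⟩
    exact ⟨P, l, h, rfl, j, hij, (hl j).1 hj⟩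

/-! ### Soundness along backward closed sets of vertices -/

/-- `B` is closed under predecessors along `E`, and `τ` interprets the fresh propositions as intended
and satisfies the input clauses whose vertices are in `B`. -/
structure Supports (C : Finset (Clause α)) (w : Literal α → α) (E : Set (Vertex α × Vertex α))
    (B : Set (Vertex α)) (τ : ℕ → Set α) : Prop where
  closed : ∀ a b, (a, b) ∈ E → b ∈ B → a ∈ B
  waits : WaitsFor C w τ
  input : ∀ c ∈ C, (⟨.main, c⟩ : Vertex α) ∈ B → c.Holds τ

/-- Closure under more edges is a stronger demand, so a statement about all supported `B` survives
the addition of edges. -/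
theorem Supports.mono {C : Finset (Clause α)} {w : Literal α → α} {E E' : Set (Vertex α × Vertex α)}
    {B : Set (Vertex α)} {τ : ℕ → Set α} (h : Supports C w E' B τ) (hE : E ⊆ E') :
    Supports C w E B τ :=
  ⟨fun a b hab => h.closed a b (hE hab), h.waits, h.input⟩

/-- The properties of the resolution graph that hold throughout an execution. -/
structure GraphInv (C : Finset (Clause α)) (w : Literal α → α) (G : ResGraph α) : Prop where
  input_mem : ∀ c ∈ C, (⟨.main, c⟩ : Vertex α) ∈ G.V
  ev_mem : ∀ P l, (⟨.main, .ev P l⟩ : Vertex α) ∈ G.V → Clause.ev P l ∈ C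
  lt_loops : ∀ k c, (⟨.loop k, c⟩ : Vertex α) ∈ G.V → k < G.loops
  sound : ∀ B τ, Supports C w G.E B τ →
    ∀ c, (⟨.main, c⟩ : Vertex α) ∈ G.V → (⟨.main, c⟩ : Vertex α) ∈ B → c.Holds τ

theorem GraphInv.initial (C : Finset (Clause α)) (w : Literal α → α) :
    GraphInv C w (ResGraph.initial C) where
  input_mem _ hc := ⟨rfl, hc⟩
  ev_mem _ _ h := h.2
  lt_loops _ _ h := absurd h.1 (by simp)
  sound _ _ hB c hV hcB := hB.input c hV.2 hcB

/-- The premises with an edge to the new vertex are in `B`, if the new vertex is. -/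
theorem Supports.premises {C : Finset (Clause α)} {w : Literal α → α} {G : ResGraph α}
    {S B : Set (Vertex α)} {v : Vertex α} {τ : ℕ → Set α}
    (h : Supports C w (G.extend S v).E B τ) (hv : v ∈ B) : S ⊆ B :=
  fun a ha => h.closed a v (Or.inr ⟨ha, rfl⟩) hv

theorem Supports.of_extend {C : Finset (Clause α)} {w : Literal α → α} {G : ResGraph α}
    {S B : Set (Vertex α)} {v : Vertex α} {τ : ℕ → Set α}
    (h : Supports C w (G.extend S v).E B τ) : Supports C w G.E B τ :=
  h.mono Set.subset_union_left

/-- No rule produces an eventuality clause, so those in the main partition stay input clauses; this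
is what makes `WaitsFor` applicable to them. -/
theorem GraphInv.extend_main {C : Finset (Clause α)} {w : Literal α → α} {G : ResGraph α}
    (hG : GraphInv C w G) {S : Set (Vertex α)} {c : Clause α} (hc : ¬ c.IsEventuality)
    (hsound : ∀ B τ, Supports C w G.E B τ → S ⊆ B → c.Holds τ) :
    GraphInv C w (G.extend S ⟨.main, c⟩) where
  input_mem c hc := Or.inr (hG.input_mem c hc)
  ev_mem P l h := by
    rcases h with h | h
    · exact absurd ⟨P, l, (congrArg Vertex.clause h).symm⟩ hc
    · exact hG.ev_mem P l h
  lt_loops k c h := by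
    rcases h with h | h
    · exact absurd (congrArg Vertex.part h) (by simp)
    · exact hG.lt_loops k c h
  sound B τ hB c' hV hc'B := by
    rcases hV with h | h
    · obtain rfl : c' = c := congrArg Vertex.clause h
      exact hsound B τ hB.of_extend (hB.premises hc'B)
    · exact hG.sound B τ hB.of_extend c' h hc'B

theorem GraphInv.extend_loop {C : Finset (Clause α)} {w : Literal α → α} {G : ResGraph α}
    (hG : GraphInv C w G) {S : Set (Vertex α)} {k : ℕ} (hk : k < G.loops) (c : Clause α) :
    GraphInv C w (G.extend S ⟨.loop k, c⟩) where
  input_mem c hc := Or.inr (hG.input_mem c hc)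
  ev_mem P l h := by
    rcases h with h | h
    · exact absurd (congrArg Vertex.part h) (by simp)
    · exact hG.ev_mem P l h
  lt_loops k' c h := by
    rcases h with h | h
    · have := congrArg Vertex.part h
      simp only [Part.loop.injEq] at this
      exact this ▸ hk
    · exact hG.lt_loops k' c h
  sound B τ hB c' hV hc'B := by
    rcases hV with h | h
    · exact absurd (congrArg Vertex.part h) (by simp)
    · exact hG.sound B τ hB.of_extend c' h hc'B

/-- The bound on loop numbers guarantees that a newly created partition is empty. -/
theorem GraphInv.newLoop {C : Finset (Clause α)} {w : Literal α → α} {G : ResGraph α}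
    (hG : GraphInv C w G) : GraphInv C w G.newLoop :=
  ⟨hG.input_mem, hG.ev_mem, fun k c h => Nat.lt_succ_of_lt (hG.lt_loops k c h), hG.sound⟩

theorem GraphInv.addEdge {C : Finset (Clause α)} {w : Literal α → α} {G : ResGraph α}
    (hG : GraphInv C w G) (a b : Vertex α) : GraphInv C w (G.addEdge a b) :=
  ⟨hG.input_mem, hG.ev_mem, hG.lt_loops,
    fun B τ hB => hG.sound B τ (hB.mono (Set.subset_insert _ _))⟩

/-- The negations of the clauses `G P` in the current loop partition form a loop in `¬ l`. -/
def LoopFound (C : Finset (Clause α)) (w : Literal α → α) (G : ResGraph α) (s : Search α) : Prop :=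
  ∀ B τ, Supports C w G.E B τ → ∀ P, (⟨.loop s.k, .global P ∅⟩ : Vertex α) ∈ G.V →
    (⟨.loop s.k, .global P ∅⟩ : Vertex α) ∈ B → ∀ i, ¬ Disj.Holds τ i P →
      ∀ j, i < j → ¬ s.l.toLTL.Sat τ j

theorem LoopFound.extend_main {C : Finset (Clause α)} {w : Literal α → α} {G : ResGraph α}
    {s : Search α} (hs : LoopFound C w G s) (S : Set (Vertex α)) (c : Clause α) :
    LoopFound C w (G.extend S ⟨.main, c⟩) s := by
  intro B τ hB P hV hPB
  rcases hV with h | h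
  · exact absurd (congrArg Vertex.part h) (by simp)
  · exact hs B τ hB.of_extend P h hPB

/-! ### Invariants of the loop search -/

section Search

variable [DecidableEq α]

/-- A clause in the current loop partition holds at a position, provided that the clauses it is
derived from by BFS-loop-it-init-c hold there. -/
def LoopSound (C : Finset (Clause α)) (w : Literal α → α) (G : ResGraph α) (s : Search α) : Prop :=
  ∀ B τ, Supports C w G.E B τ → ∀ i,
    (∀ R ∈ s.prev, (⟨.loop s.k, .global ∅ (insert s.l R)⟩ : Vertex α) ∈ B →
      Disj.Holds τ (i + 1) (insert s.l R)) →
    ∀ P Q, (⟨.loop s.k, .global P Q⟩ : Vertex α) ∈ G.V →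
      (⟨.loop s.k, .global P Q⟩ : Vertex α) ∈ B → Disj.Holds τ i P ∨ Disj.Holds τ (i + 1) Q

/-- Each clause of the previous iteration outside `D` is linked to a clause that subsumes it. -/
def Subsumed (G : ResGraph α) (s : Search α) (D : Set (Disj α)) : Prop :=
  ∀ R ∈ s.prev, R ∉ D → ∃ P ∈ G.emptyX s.k, P ⊆ R ∧
    ((⟨.loop s.k, .global P ∅⟩, ⟨.loop s.k, .global ∅ (insert s.l R)⟩) :
      Vertex α × Vertex α) ∈ G.E

/-- The phases outside of loop searches, which may follow the saturation of the main partition. -/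
def Phase.OutsideSearch : Phase α → Prop
  | .augment => True
  | .whileTest _ => True
  | .forEach _ _ => True
  | _ => False

/-- The properties of the resolution graph that depend on the phase. -/
def PhaseInv (C : Finset (Clause α)) (w : Literal α → α) (G : ResGraph α) : Phase α → Prop
  | .saturate next => next.OutsideSearch
  | .loopInit s => s.k < G.loops ∧ LoopSound C w G s
  | .loopSaturate s => s.k < G.loops ∧ LoopSound C w G s
  | .loopSubsume s D => s.k < G.loops ∧ LoopSound C w G s ∧ Subsumed G s D
  | .loopConclude s => s.k < G.loops ∧ LoopFound C w G s
  | _ => True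

theorem Phase.OutsideSearch.phaseInv {p : Phase α} (h : p.OutsideSearch)
    (C : Finset (Clause α)) (w : Literal α → α) (G : ResGraph α) : PhaseInv C w G p := by
  cases p <;> simp_all [Phase.OutsideSearch, PhaseInv]

/-- Failure of a loop clause propagates one position forward along the subsumption edges, and `l`
fails at each position reached. This may cycle among finitely or infinitely many clauses; the
induction is on the distance to `j`, not on derivations. -/
theorem LoopSound.loopFound {C : Finset (Clause α)} {w : Literal α → α} {G : ResGraph α}
    {s : Search α} (hs : LoopSound C w G s) (hsub : Subsumed G s ∅) : LoopFound C w G s := by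
  intro B τ hB P hPV hPB i hP j hij
  induction hn : j - i generalizing i P with
  | zero => omega
  | succ n ih =>
    -- Contrapositive of conditional soundness at `i`: `G P` has an empty `X` part, so if `P` fails,
    -- one of the unlinked BFS-loop-it-init-c clauses in `B` must be violated.
    obtain ⟨R, hR, hRB, hRn⟩ : ∃ R ∈ s.prev,
        (⟨.loop s.k, .global ∅ (insert s.l R)⟩ : Vertex α) ∈ B ∧
          ¬ Disj.Holds τ (i + 1) (insert s.l R) := by
      by_contra! hcon
      rcases hs B τ hB i hcon P ∅ hPV hPB with h | h
      · exact hP h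
      · exact Disj.holds_empty _ _ h
    rw [Disj.holds_insert, not_or] at hRn
    obtain ⟨P', hP', hsubset, hE⟩ := hsub R hR (Set.notMem_empty R)
    rcases Nat.lt_or_ge (i + 1) j with hlt | hge
    -- The subsumption edge puts the vertex of `P'` in `B`, so the argument repeats from `i + 1`.
    · exact ih P' hP' (hB.closed _ _ hE hRB) (i + 1) (fun h => hRn.2 (h.mono hsubset)) hlt
        (by omega)
    · obtain rfl : j = i + 1 := by omega
      exact hRn.1

/-- Vacuous, since the new partition has no vertices. -/
theorem GraphInv.loopSound_newLoop {C : Finset (Clause α)} {w : Literal α → α} {G : ResGraph α}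
    (hG : GraphInv C w G) (s : Search α) (hs : s.k = G.loops) : LoopSound C w G.newLoop s := by
  intro B τ _ i _ P Q hV
  exact absurd (hG.lt_loops _ _ hV) (by omega)

theorem LoopSound.extend {C : Finset (Clause α)} {w : Literal α → α} {G : ResGraph α}
    {s : Search α} (hs : LoopSound C w G s) {S : Set (Vertex α)} {P Q : Disj α}
    (h : ∀ B τ, Supports C w G.E B τ → S ⊆ B → ∀ i,
      (∀ R ∈ s.prev, (⟨.loop s.k, .global ∅ (insert s.l R)⟩ : Vertex α) ∈ B →
        Disj.Holds τ (i + 1) (insert s.l R)) →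
      (⟨.loop s.k, .global P Q⟩ : Vertex α) ∈ B →
      Disj.Holds τ i P ∨ Disj.Holds τ (i + 1) Q) :
    LoopSound C w (G.extend S ⟨.loop s.k, .global P Q⟩) s := by
  intro B τ hB i hprev P' Q' hV hB'
  rcases hV with hV | hV
  · have := congrArg Vertex.clause hV
    simp only [Clause.global.injEq] at this
    obtain ⟨rfl, rfl⟩ := this
    exact h B τ hB.of_extend (hB.premises hB') i hprev hB'
  · exact hs B τ hB.of_extend i hprev P' Q' hV hB'

/-! ### Soundness of the production rules -/

theorem Disj.holds_resolvent {σ : ℕ → Set α} {i : ℕ} {l : Literal α} {P Q : Disj α}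
    (h₁ : Disj.Holds σ i (insert l P)) (h₂ : Disj.Holds σ i (insert l.neg Q)) :
    Disj.Holds σ i (P ∪ Q) := by
  rw [Disj.holds_insert] at h₁ h₂
  rw [Literal.sat_neg] at h₂
  rw [Disj.holds_union]
  tauto

/-- The implication is stated at a single position because loop clauses are known to hold only at
positions where the condition of `LoopSound` is met. The same form serves the main partition. -/
theorem StepXX.exists_global {p : Part} {V S : Set (Vertex α)} {v : Vertex α}
    (h : StepXX p V S v) :
    ∃ P Q, v = ⟨p, .global P Q⟩ ∧ ∃ P₁ Q₁ P₂ Q₂,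
      (⟨p, .global P₁ Q₁⟩ : Vertex α) ∈ V ∧ (⟨p, .global P₂ Q₂⟩ : Vertex α) ∈ V ∧
      (⟨p, .global P₁ Q₁⟩ : Vertex α) ∈ S ∧ (⟨p, .global P₂ Q₂⟩ : Vertex α) ∈ S ∧
      ∀ (σ : ℕ → Set α) (i : ℕ), (Disj.Holds σ i P₁ ∨ Disj.Holds σ (i + 1) Q₁) →
        (Disj.Holds σ i P₂ ∨ Disj.Holds σ (i + 1) Q₂) →
        Disj.Holds σ i P ∨ Disj.Holds σ (i + 1) Q := by
  obtain ⟨P, Q, R, S, l, -, -, h₁, h₂⟩ := h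
  refine ⟨_, _, rfl, _, _, _, _, h₁, h₂, Or.inl rfl, Or.inr rfl, fun σ i a b => ?_⟩
  rw [Disj.holds_union]
  rcases a with a | a
  · exact Or.inl (Or.inl a)
  rcases b with b | b
  · exact Or.inl (Or.inr b)
  exact Or.inr (Disj.holds_resolvent a b)

theorem GraphInv.saturation {C : Finset (Clause α)} {w : Literal α → α} {G G' : ResGraph α}
    (hG : GraphInv C w G) (h : Generates Saturation G G') : GraphInv C w G' := by
  obtain ⟨S, v, h, -, rfl⟩ := h
  cases h with
  | init_ii P Q l _ _ h₁ h₂ =>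
    refine hG.extend_main (by rintro ⟨_, _, ⟨⟩⟩) fun B τ hB hS => ?_
    have a := hG.sound B τ hB _ h₁ (hS (Or.inl rfl))
    have b := hG.sound B τ hB _ h₂ (hS (Or.inr rfl))
    rw [Clause.holds_init] at a b ⊢
    exact Disj.holds_resolvent a b
  | init_in P Q l _ _ h₁ h₂ =>
    refine hG.extend_main (by rintro ⟨_, _, ⟨⟩⟩) fun B τ hB hS => ?_
    have a := hG.sound B τ hB _ h₁ (hS (Or.inl rfl))
    have b := hG.sound B τ hB _ h₂ (hS (Or.inr rfl))
    rw [Clause.holds_init] at a ⊢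
    rw [Clause.holds_global] at b
    exact Disj.holds_resolvent a ((b 0).resolve_right (Disj.holds_empty _ _))
  | step_nn P Q l _ _ h₁ h₂ =>
    refine hG.extend_main (by rintro ⟨_, _, ⟨⟩⟩) fun B τ hB hS => ?_
    have a := hG.sound B τ hB _ h₁ (hS (Or.inl rfl))
    have b := hG.sound B τ hB _ h₂ (hS (Or.inr rfl))
    rw [Clause.holds_global] at a b ⊢
    exact fun i => Or.inl (Disj.holds_resolvent ((a i).resolve_right (Disj.holds_empty _ _))
      ((b i).resolve_right (Disj.holds_empty _ _)))
  | step_nx P Q R l _ _ h₁ h₂ =>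
    refine hG.extend_main (by rintro ⟨_, _, ⟨⟩⟩) fun B τ hB hS => ?_
    have a := hG.sound B τ hB _ h₁ (hS (Or.inl rfl))
    have b := hG.sound B τ hB _ h₂ (hS (Or.inr rfl))
    rw [Clause.holds_global] at a b ⊢
    exact fun i => (b i).imp_right
      (Disj.holds_resolvent ((a (i + 1)).resolve_right (Disj.holds_empty _ _)))
  | step_xx _ _ h =>
    obtain ⟨P, Q, rfl, P₁, Q₁, P₂, Q₂, hV₁, hV₂, hS₁, hS₂, himp⟩ := h.exists_global
    refine hG.extend_main (by rintro ⟨_, _, ⟨⟩⟩) fun B τ hB hS => ?_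
    have a := hG.sound B τ hB _ hV₁ (hS hS₁)
    have b := hG.sound B τ hB _ hV₂ (hS hS₂)
    rw [Clause.holds_global] at a b ⊢
    exact fun i => himp τ i (a i) (b i)

theorem GraphInv.augmentation {C : Finset (Clause α)} {w : Literal α → α} {G G' : ResGraph α}
    (hG : GraphInv C w G) (h : Generates (Augmentation w) G G') : GraphInv C w G' := by
  obtain ⟨S, v, h, -, rfl⟩ := h
  cases h with
  | aug1 P l h =>
    refine hG.extend_main (by rintro ⟨_, _, ⟨⟩⟩) fun B τ hB hS => ?_
    have a := hG.sound B τ hB _ h (hS rfl)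
    rw [Clause.holds_ev] at a
    rw [Clause.holds_global]
    intro i
    rw [Disj.holds_union, Disj.holds_insert, Disj.holds_singleton, Literal.sat_pos,
      hB.waits P l (hG.ev_mem P l h) i]
    rcases a i with a | ⟨j, hij, hj⟩
    · exact Or.inl (Or.inl a)
    · rcases hij.eq_or_lt with rfl | hlt
      · exact Or.inl (Or.inr (Or.inl hj))
      · exact Or.inl (Or.inr (Or.inr ⟨j, hlt, hj⟩))
  | aug2 P l h =>
    refine hG.extend_main (by rintro ⟨_, _, ⟨⟩⟩) fun B τ hB hS => ?_
    -- The premise has no edge and need not hold in `τ`; its membership in `C` suffices to know what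
    -- `w l` means.
    have hw := hB.waits P l (hG.ev_mem P l h)
    rw [Clause.holds_global]
    intro i
    rw [Disj.holds_insert, Disj.holds_singleton, Disj.holds_singleton, Literal.sat_neg,
      Literal.sat_pos, Literal.sat_pos, hw, hw, or_iff_not_imp_left, not_not]
    rintro ⟨j, hij, hj⟩
    -- A witness strictly after `i` is either `i + 1`, giving `l` there, or later, giving `w l`
    -- there.
    rcases (Nat.succ_le_of_lt hij).eq_or_lt with rfl | hlt
    · exact Or.inl hj
    · exact Or.inr ⟨j, hlt, hj⟩

/-- Clauses copied from the main partition are sound outright through their edges; the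
BFS-loop-it-init-c case is exactly the assumption in `LoopSound`. -/
theorem GraphInv.loopInit {C : Finset (Clause α)} {w : Literal α → α} {G G' : ResGraph α}
    {s : Search α} (hG : GraphInv C w G) (hk : s.k < G.loops) (hs : LoopSound C w G s)
    (h : Generates (LoopInit s.l s.prev s.k) G G') :
    GraphInv C w G' ∧ s.k < G'.loops ∧ LoopSound C w G' s := by
  obtain ⟨S, v, h, -, rfl⟩ := h
  cases h with
  | init_x P Q _ h =>
    refine ⟨hG.extend_loop hk _, hk, hs.extend fun B τ hB hS i _ _ => ?_⟩
    exact (Clause.holds_global τ P Q).1 (hG.sound B τ hB _ h (hS rfl)) i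
  | init_n P h =>
    refine ⟨hG.extend_loop hk _, hk, hs.extend fun B τ hB hS i _ _ => Or.inr ?_⟩
    exact ((Clause.holds_global τ P ∅).1 (hG.sound B τ hB _ h (hS rfl)) (i + 1)).resolve_right
      (Disj.holds_empty _ _)
  | init_c P h =>
    exact ⟨hG.extend_loop hk _, hk, hs.extend fun B τ _ _ i hprev hv => Or.inr (hprev P h hv)⟩

theorem GraphInv.loopSaturate {C : Finset (Clause α)} {w : Literal α → α} {G G' : ResGraph α}
    {s : Search α} (hG : GraphInv C w G) (hk : s.k < G.loops) (hs : LoopSound C w G s)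
    (h : Generates (StepXX (.loop s.k)) G G') :
    GraphInv C w G' ∧ s.k < G'.loops ∧ LoopSound C w G' s := by
  obtain ⟨S, v, h, -, rfl⟩ := h
  obtain ⟨P, Q, rfl, P₁, Q₁, P₂, Q₂, hV₁, hV₂, hS₁, hS₂, himp⟩ := h.exists_global
  refine ⟨hG.extend_loop hk _, hk, hs.extend fun B τ hB hS i hprev _ => ?_⟩
  exact himp τ i (hs B τ hB i hprev _ _ hV₁ (hS hS₁)) (hs B τ hB i hprev _ _ hV₂ (hS hS₂))

theorem GraphInv.loopConclude {C : Finset (Clause α)} {w : Literal α → α} {G G' : ResGraph α}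
    {s : Search α} (hG : GraphInv C w G) (hk : s.k < G.loops) (hs : LoopFound C w G s)
    (h : Generates (LoopConclusion w s.Q s.l s.k) G G') :
    GraphInv C w G' ∧ s.k < G'.loops ∧ LoopFound C w G' s := by
  obtain ⟨S, v, h, -, rfl⟩ := h
  cases h with
  | conclusion1 P h₁ h₂ =>
    refine ⟨hG.extend_main (by rintro ⟨_, _, ⟨⟩⟩) fun B τ hB hS => ?_, hk, hs.extend_main _ _⟩
    have a := (Clause.holds_ev _ _ _).1 (hG.sound B τ hB _ h₂ (hS (Or.inr rfl)))
    have b := hs B τ hB P h₁ (hS (Or.inl rfl))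
    rw [Clause.holds_global]
    refine fun i => Or.inl ?_
    rw [Disj.holds_union, Disj.holds_union, Disj.holds_singleton]
    rcases a i with a | ⟨j, hij, hj⟩
    · exact Or.inl (Or.inr a)
    · rcases hij.eq_or_lt with rfl | hlt
      · exact Or.inr hj
      -- The promised `l` comes strictly after `i`, which the loop forbids when `P` fails at `i`.
      · exact Or.inl (Or.inl (by_contra fun hP => b i hP j hlt hj))
  | conclusion2 P h₁ h₂ =>
    refine ⟨hG.extend_main (by rintro ⟨_, _, ⟨⟩⟩) fun B τ hB hS => ?_, hk, hs.extend_main _ _⟩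
    -- As for aug2, the unlinked eventuality clause only supplies the meaning of `w l`.
    have hw := hB.waits _ _ (hG.ev_mem _ _ h₂)
    have b := hs B τ hB P h₁ (hS rfl)
    rw [Clause.holds_global]
    intro i
    rw [Disj.holds_union, Disj.holds_singleton, Disj.holds_singleton, Literal.sat_neg,
      Literal.sat_pos, hw, or_iff_not_imp_left, not_not]
    rintro ⟨j, hij, hj⟩
    rcases (Nat.succ_le_of_lt hij).eq_or_lt with rfl | hlt
    · exact Or.inr hj
    · exact Or.inl (by_contra fun hP => b (i + 1) hP j hlt hj)

theorem Subsumed.addEdge {G : ResGraph α} {s : Search α} {D : Set (Disj α)}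
    (h : Subsumed G s D) {P R : Disj α} (hP : P ∈ G.emptyX s.k) (hPR : P ⊆ R) :
    Subsumed (G.addEdge ⟨.loop s.k, .global P ∅⟩ ⟨.loop s.k, .global ∅ (insert s.l R)⟩) s
      (D \ {R}) := by
  intro R' hR' hD
  by_cases hRR : R' = R
  · subst hRR
    exact ⟨P, hP, hPR, Set.mem_insert _ _⟩
  · obtain ⟨P', hP', hsub, hE⟩ := h R' hR' fun hmem => hD ⟨hmem, hRR⟩
    exact ⟨P', hP', hsub, Set.mem_insert_of_mem _ hE⟩

/-! ### Soundness of executions -/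

/-- Starting the subsumption test makes `Subsumed` vacuous, since all of `prev` is still pending; a
found loop is the case where nothing is pending. -/
theorem Step.inv {C : Finset (Clause α)} {w : Literal α → α} {x y : ResGraph α × Phase α}
    (h : Step C w x y) (hx : GraphInv C w x.1 ∧ PhaseInv C w x.1 x.2) :
    GraphInv C w y.1 ∧ PhaseInv C w y.1 y.2 := by
  obtain ⟨hG, hp⟩ := hx
  cases h with
  | start_unsat => exact ⟨hG, trivial⟩
  | start_done => exact ⟨hG, trivial⟩
  | saturate_apply _ _ _ h => exact ⟨hG.saturation h, hp⟩
  | saturate_unsat => exact ⟨hG, trivial⟩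
  | saturate_done => exact ⟨hG, Phase.OutsideSearch.phaseInv hp C w _⟩
  | augment_apply _ _ h => exact ⟨hG.augmentation h, trivial⟩
  | augment_done => exact ⟨hG, trivial⟩
  | while_enter => exact ⟨hG, trivial⟩
  | while_exit => exact ⟨hG, trivial⟩
  | for_enter => exact ⟨hG.newLoop, Nat.lt_succ_self _, hG.loopSound_newLoop _ rfl⟩
  | for_exit => exact ⟨hG, trivial⟩
  | loopInit_apply _ _ _ h => exact hG.loopInit hp.1 hp.2 h
  | loopInit_done => exact ⟨hG, hp⟩
  | loopSaturate_apply _ _ _ h => exact hG.loopSaturate hp.1 hp.2 h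
  | loopSaturate_done => exact ⟨hG, hp.1, hp.2, fun R hR hR' => absurd hR hR'⟩
  | subsume_apply _ _ _ _ _ _ hP h =>
    exact ⟨hG.addEdge _ _, hp.1,
      fun B τ hB => hp.2.1 B τ (hB.mono (Set.subset_insert _ _)), hp.2.2.addEdge hP h⟩
  | subsume_found => exact ⟨hG, hp.1, hp.2.1.loopFound hp.2.2⟩
  | subsume_fail => exact ⟨hG, trivial⟩
  | subsume_repeat => exact ⟨hG.newLoop, Nat.lt_succ_self _, hG.loopSound_newLoop _ rfl⟩
  | conclude_apply _ _ _ h => exact hG.loopConclude hp.1 hp.2 h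
  | conclude_done => exact ⟨hG, trivial⟩

theorem ShowsUnsat.graphInv {C : Finset (Clause α)} {w : Literal α → α} {G : ResGraph α}
    (h : ShowsUnsat C w G) : GraphInv C w G := by
  suffices H : ∀ y, Relation.ReflTransGen (Step C w) (ResGraph.initial C, .start) y →
      GraphInv C w y.1 ∧ PhaseInv C w y.1 y.2 from (H _ h).1
  intro y hy
  induction hy with
  | refl => exact ⟨GraphInv.initial C w, trivial⟩
  | tail _ hstep ih => exact hstep.inv ih

end Search

end TR

theorem mainTheorem1 {AP : Type*} [DecidableEq AP] (C : Finset (TR.Clause AP))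
    (w : TR.Literal AP → AP) (hw : TR.IsFresh C w)
    (G : TR.ResGraph AP) (hG : TR.ShowsUnsat C w G)
    (v : TR.Vertex AP) (hv : v ∈ G.V) (hmain : v.part = TR.Part.main)
    (hempty : v.clause.IsEmpty) :
    TR.Unsat (TR.ResGraph.core C G v) := by
  rintro ⟨σ, hσ⟩
  have hinv := hG.graphInv
  obtain ⟨τ, hwait, hiff⟩ := TR.exists_waitsFor hw σ
  -- Backward reachability from `v` is the closed set to use: an input clause whose main vertex lies
  -- in it belongs to the core by definition.
  have hsupp : TR.Supports C w G.E {u | G.BackReach v u} τ :=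
    ⟨fun a b hab hb => Relation.ReflTransGen.head hab hb, hwait, fun c hc hreach =>
      (hiff c hc).1 (hσ c ⟨hc, _, hinv.input_mem c hc, hreach, rfl, rfl⟩)⟩
  obtain ⟨p, c⟩ := v
  obtain rfl : p = TR.Part.main := hmain
  exact hempty.not_holds τ (hinv.sound _ τ hsupp c hv Relation.ReflTransGen.refl)
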